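/- Let $d\ge 1$, $s\in(0,1)$ and $\lambda,\Lambda>0$. Write $B_r=\{y\in\mathbb R^d: |y|<r\}$. For $\rho>0$ let $\mathcal K_\rho$ be the set of (Lebesgue measurable) kernels $K\colon\mathbb R^d\to[0,\infty)$ such that $$K(y)\ge \lambda\min\{|y|^{-d-2s},\rho^{-d-2s}\}\ \text{ for all } y\neq 0,\qquad \int_{B_{2r}\setminus B_r}K(y)\,dy\le \Lambda r^{-2s}\ \text{ for all } r>0,$$ and, in the case $s=1/2$, additionally $\int_{B_{2r}\setminus B_r}yK(y)\,dy=0$ for all $r>0$. Let $$\mathcal S_\rho=\{K\in\mathcal K_\rho : K\in L^1(\mathbb R^d),\ K(y)=K(-y)\text{ for almost every }y\in\mathbb R^d\}.$$ Then there exist $\alpha\in(0,2s)$ and $C>0$, depending only on $d,s,\lambda$ and $\Lambda$, with the following property. Let $A\ge 0$, $R>2\rho>0$, and let $u\in C(B_R)\cap L^\infty(\mathbb R^d)$ satisfy $$\sup_{K\in\mathcal S_\rho}\int_{\mathbb R^d}\bigl(u(x+y)+u(x-y)-2u(x)\bigr)K(y)\,dy\ge -A$$ and $$\inf_{K\in\mathcal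 S_\rho}\int_{\mathbb R^d}\bigl(u(x+y)+u(x-y)-2u(x)\bigr)K(y)\,dy\le A$$ for every $x\in B_R$, where the supremum and the infimum are taken in $[-\infty,\infty]$. Then $$\sup_{\substack{x,y\in B_{R/4}\\ |x-y|\ge\rho}}\frac{|u(x)-u(y)|}{|x-y|^\alpha}\le \frac{C}{R^\alpha}\Bigl(\|u\|_{L^\infty(\mathbb R^d)}+R^{2s}A\Bigr).$$ -/

import Mathlib

namespace IntegroDiff

open MeasureTheory

/-- The truncated fractional profile `min {|y|^{-d-2s}, ρ^{-d-2s}}`, with the convention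
`ρ^{-d-2s} = ∞` for `ρ = 0`. -/
noncomputable def truncProfile (d : ℕ) (s ρ : ℝ) (y : EuclideanSpace ℝ (Fin d)) : ℝ :=
  if ρ = 0 then ‖y‖ ^ (-(d : ℝ) - 2 * s)
  else min (‖y‖ ^ (-(d : ℝ) - 2 * s)) (ρ ^ (-(d : ℝ) - 2 * s))

/-- The dyadic annulus `B_{2r} \ B_r` centred at the origin. -/
def annulus (d : ℕ) (r : ℝ) : Set (EuclideanSpace ℝ (Fin d)) :=
  Metric.ball 0 (2 * r) \ Metric.ball 0 r

/-- `K` belongs to the class `𝒦_ρ` of admissible kernels of order `2s` with ellipticity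
constants `lam` and `Lam`. -/
structure IsAdmissible (d : ℕ) (s lam Lam ρ : ℝ) (K : EuclideanSpace ℝ (Fin d) → ℝ) : Prop where
  aemeasurable : AEMeasurable K volume
  nonneg : ∀ y, 0 ≤ K y
  lower : ∀ y, y ≠ 0 → lam * truncProfile d s ρ y ≤ K y
  upper : ∀ r : ℝ, 0 < r →
    ∫⁻ y in annulus d r, ENNReal.ofReal (K y) ≤ ENNReal.ofReal (Lam * r ^ (-(2 * s)))
  cancel : s = 1 / 2 → ∀ r : ℝ, 0 < r → ∫ y in annulus d r, K y • y = 0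

/-- The class `𝒮_ρ` of integrable, symmetric admissible kernels. -/
def symKernels (d : ℕ) (s lam Lam ρ : ℝ) : Set (EuclideanSpace ℝ (Fin d) → ℝ) :=
  {K | IsAdmissible d s lam Lam ρ K ∧ Integrable K volume ∧ ∀ᵐ y, K y = K (-y)}

/-- `∫ (u(x+y) + u(x-y) - 2u(x)) K(y) dy`; the integrand is integrable whenever `u` is
essentially bounded and `K` is integrable. -/
noncomputable def symOp {d : ℕ} (K u : EuclideanSpace ℝ (Fin d) → ℝ)
    (x : EuclideanSpace ℝ (Fin d)) : ℝ :=
  ∫ y, (u (x + y) + u (x - y) - 2 * u x) * K y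

/-- `sup_{K ∈ 𝒮_ρ} ∫ (u(x+y) + u(x-y) - 2u(x)) K(y) dy`, as an extended real number. -/
noncomputable def symSup {d : ℕ} (s lam Lam ρ : ℝ) (u : EuclideanSpace ℝ (Fin d) → ℝ)
    (x : EuclideanSpace ℝ (Fin d)) : EReal :=
  ⨆ K ∈ symKernels d s lam Lam ρ, ((symOp K u x : ℝ) : EReal)

/-- `inf_{K ∈ 𝒮_ρ} ∫ (u(x+y) + u(x-y) - 2u(x)) K(y) dy`, as an extended real number. -/
noncomputable def symInf {d : ℕ} (s lam Lam ρ : ℝ) (u : EuclideanSpace ℝ (Fin d) → ℝ)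
    (x : EuclideanSpace ℝ (Fin d)) : EReal :=
  ⨅ K ∈ symKernels d s lam Lam ρ, ((symOp K u x : ℝ) : EReal)

end IntegroDiff

/-! ### Moments of admissible kernels over dyadic annuli. -/

namespace IntegroDiff
open MeasureTheory Metric
open scoped ENNReal

variable {d : ℕ} {s lam Lam ρ : ℝ} {K : EuclideanSpace ℝ (Fin d) → ℝ}

/-! The heart is a one-scale improvement (`exists_improvement`) that needs no covering argument,
since every kernel is bounded below pointwise on `B_{2r}` when `ρ ≤ 2r`. Suppose `w ≤ 1` on a ball,
`w ≤ 0` on half of it in measure, and `w` grows slowly outside. If `w` came close to `1` on the half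
ball, subtracting a small paraboloid would give an interior maximum. There the positive part of the
second difference is small, its cost being controlled by a second moment near the origin and an
`s`-moment far away, while the set `w ≤ 0` contributes a fixed negative multiple of `r ^ (-2s)`:
this contradicts the equation (`increment_le`, `exists_symOp_le`).

Applied to a normalization of `u` or of `-u`, whichever has the large sublevel set, this shrinks the
oscillation by `2 ^ (-α)` when the radius is halved (`exists_osc_decay`). `OscBound` carries the
tail along with the oscillation so that the step can be repeated. Iterating down to the scale `‖x -
y‖ ≥ ρ` gives the Hölder bound. -/

theorem measurableSet_annulus (r : ℝ) : MeasurableSet (annulus d r) :=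
  measurableSet_ball.diff measurableSet_ball

theorem mem_annulus {r : ℝ} {y : EuclideanSpace ℝ (Fin d)} :
    y ∈ annulus d r ↔ r ≤ ‖y‖ ∧ ‖y‖ < 2 * r := by
  simp [annulus, and_comm]

theorem IsAdmissible.lintegral_annulus_le (hK : IsAdmissible d s lam Lam ρ K) {p r : ℝ}
    (hp : 0 ≤ p) (hr : 0 < r) :
    ∫⁻ y in annulus d r, ENNReal.ofReal (‖y‖ ^ p * K y) ≤
      ENNReal.ofReal (2 ^ p * Lam * r ^ (p - 2 * s)) := by
  calc ∫⁻ y in annulus d r, ENNReal.ofReal (‖y‖ ^ p * K y)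
      ≤ ∫⁻ y in annulus d r, ENNReal.ofReal ((2 * r) ^ p) * ENNReal.ofReal (K y) := by
        refine setLIntegral_mono' (measurableSet_annulus r) fun y hy => ?_
        rw [← ENNReal.ofReal_mul (by positivity)]
        refine ENNReal.ofReal_le_ofReal (mul_le_mul_of_nonneg_right ?_ (hK.nonneg y))
        exact Real.rpow_le_rpow (norm_nonneg y) (mem_annulus.1 hy).2.le hp
    _ = ENNReal.ofReal ((2 * r) ^ p) * ∫⁻ y in annulus d r, ENNReal.ofReal (K y) :=
        lintegral_const_mul' _ _ ENNReal.ofReal_ne_top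
    _ ≤ ENNReal.ofReal ((2 * r) ^ p) * ENNReal.ofReal (Lam * r ^ (-(2 * s))) := by
        gcongr
        exact hK.upper r hr
    _ = ENNReal.ofReal (2 ^ p * Lam * r ^ (p - 2 * s)) := by
        rw [← ENNReal.ofReal_mul (by positivity), Real.mul_rpow (by norm_num) hr.le,
          sub_eq_add_neg, Real.rpow_add hr]
        congr 1
        ring

/-- Moments of an admissible kernel over a set covered by a geometric sequence of annuli. -/
theorem IsAdmissible.lintegral_le_of_subset_iUnion (hK : IsAdmissible d s lam Lam ρ K)
    (hLam : 0 < Lam) {p a b : ℝ} (hp : 0 ≤ p) (ha : 0 < a) (hb : 0 < b)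
    (hb1 : b ^ (p - 2 * s) < 1) {S : Set (EuclideanSpace ℝ (Fin d))}
    (hS : S ⊆ ⋃ j : ℕ, annulus d (a * b ^ j)) :
    ∫⁻ y in S, ENNReal.ofReal (‖y‖ ^ p * K y) ≤
      ENNReal.ofReal (2 ^ p * Lam / (1 - b ^ (p - 2 * s)) * a ^ (p - 2 * s)) := by
  have hq0 : 0 ≤ b ^ (p - 2 * s) := by positivity
  have hsum := (summable_geometric_of_lt_one hq0 hb1).mul_left (2 ^ p * Lam * a ^ (p - 2 * s))
  calc ∫⁻ y in S, ENNReal.ofReal (‖y‖ ^ p * K y)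
      ≤ ∫⁻ y in ⋃ j : ℕ, annulus d (a * b ^ j), ENNReal.ofReal (‖y‖ ^ p * K y) :=
        lintegral_mono_set hS
    _ ≤ ∑' j : ℕ, ∫⁻ y in annulus d (a * b ^ j), ENNReal.ofReal (‖y‖ ^ p * K y) :=
        lintegral_iUnion_le _ _
    _ ≤ ∑' j : ℕ, ENNReal.ofReal (2 ^ p * Lam * a ^ (p - 2 * s) * (b ^ (p - 2 * s)) ^ j) := by
        refine ENNReal.tsum_le_tsum fun j =>
          (hK.lintegral_annulus_le hp (by positivity)).trans_eq ?_
        rw [Real.mul_rpow ha.le (by positivity), ← Real.rpow_natCast b j, ← Real.rpow_mul hb.le,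
          ← Real.rpow_natCast _ j, ← Real.rpow_mul hb.le, mul_comm (j : ℝ), mul_assoc]
        ring_nf
    _ = ENNReal.ofReal (2 ^ p * Lam / (1 - b ^ (p - 2 * s)) * a ^ (p - 2 * s)) := by
        rw [← ENNReal.ofReal_tsum_of_nonneg (fun j => by positivity) hsum, tsum_mul_left,
          tsum_geometric_of_lt_one hq0 hb1]
        congr 1
        ring

theorem ball_diff_subset_iUnion_annulus {r : ℝ} :
    ball (0 : EuclideanSpace ℝ (Fin d)) r \ {0} ⊆
      ⋃ j : ℕ, annulus d (r / 2 * (1 / 2 : ℝ) ^ j) := by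
  rintro y ⟨hy, hy0⟩
  have hy0 : 0 < ‖y‖ := norm_pos_iff.2 hy0
  rw [mem_ball_zero_iff] at hy
  obtain ⟨n, h1, h2⟩ := exists_nat_pow_near (x := r / ‖y‖) (y := 2)
    ((one_le_div hy0).2 hy.le) (by norm_num)
  rw [le_div_iff₀ hy0] at h1
  rw [div_lt_iff₀ hy0] at h2
  rcases h1.lt_or_eq with h1 | h1
  · refine Set.mem_iUnion.2 ⟨n, mem_annulus.2 ⟨?_, ?_⟩⟩
    · rw [one_div, inv_pow, ← div_eq_mul_inv, div_le_iff₀ (by positivity)]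
      rw [pow_succ] at h2
      linarith
    · rw [one_div, inv_pow, ← div_eq_mul_inv, mul_div_assoc', lt_div_iff₀ (by positivity)]
      linarith
  -- If `‖y‖ = r / 2 ^ n`, then `y` lies on the excluded outer sphere of annulus `n`, hence on the
  -- inner sphere of annulus `n - 1`.
  · have hn : n ≠ 0 := by
      rintro rfl
      simp at h1
      linarith
    obtain ⟨m, rfl⟩ := Nat.exists_eq_succ_of_ne_zero hn
    refine Set.mem_iUnion.2 ⟨m, mem_annulus.2 ⟨?_, ?_⟩⟩
    · rw [one_div, inv_pow, ← div_eq_mul_inv, div_le_iff₀ (by positivity)]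
      rw [Nat.succ_eq_add_one, pow_succ] at h1
      linarith
    · rw [one_div, inv_pow, ← div_eq_mul_inv, mul_div_assoc', lt_div_iff₀ (by positivity)]
      rw [Nat.succ_eq_add_one, pow_succ] at h1
      have : 0 < 2 ^ m * ‖y‖ := by positivity
      linarith

theorem compl_ball_subset_iUnion_annulus {r : ℝ} (hr : 0 < r) :
    (ball (0 : EuclideanSpace ℝ (Fin d)) r)ᶜ ⊆ ⋃ j : ℕ, annulus d (r * 2 ^ j) := by
  intro y hy
  rw [Set.mem_compl_iff, mem_ball_zero_iff, not_lt] at hy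
  obtain ⟨n, h1, h2⟩ := exists_nat_pow_near (x := ‖y‖ / r) (y := 2)
    ((one_le_div hr).2 hy) (by norm_num)
  rw [le_div_iff₀ hr] at h1
  rw [div_lt_iff₀ hr, pow_succ] at h2
  exact Set.mem_iUnion.2 ⟨n, mem_annulus.2 ⟨by linarith, by linarith⟩⟩

theorem integrable_and_integral_le_of_lintegral_le {α : Type*} [MeasurableSpace α] {μ : Measure α}
    {f : α → ℝ} {M : ℝ} (hf : AEStronglyMeasurable f μ) (hf0 : ∀ x, 0 ≤ f x) (hM : 0 ≤ M)
    (h : ∫⁻ x, ENNReal.ofReal (f x) ∂μ ≤ ENNReal.ofReal M) :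
    Integrable f μ ∧ ∫ x, f x ∂μ ≤ M := by
  have h0 : 0 ≤ᵐ[μ] f := Filter.Eventually.of_forall hf0
  refine ⟨⟨hf, ?_⟩, ?_⟩
  · rw [hasFiniteIntegral_iff_ofReal h0]
    exact h.trans_lt ENNReal.ofReal_lt_top
  · rw [integral_eq_lintegral_of_nonneg_ae h0 hf]
    exact ENNReal.toReal_le_of_le_ofReal hM h

/-- The annular bounds scale by `(1/2) ^ (2 - 2s)`, a convergent ratio because `s < 1`. This pays
for the touching paraboloid. -/
theorem IsAdmissible.near_moment (hK : IsAdmissible d s lam Lam ρ K) (hLam : 0 < Lam)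
    (hs1 : s < 1) {r : ℝ} (hr : 0 < r) :
    IntegrableOn (fun y => ‖y‖ ^ 2 * K y) (ball 0 r) ∧
      ∫ y in ball 0 r, ‖y‖ ^ 2 * K y ≤
        2 ^ 2 * Lam / (1 - (1 / 2 : ℝ) ^ (2 - 2 * s)) * r ^ (2 - 2 * s) := by
  have hq : (1 / 2 : ℝ) ^ (2 - 2 * s) < 1 :=
    Real.rpow_lt_one (by norm_num) (by norm_num) (by linarith)
  have hC : 0 ≤ 2 ^ 2 * Lam / (1 - (1 / 2 : ℝ) ^ (2 - 2 * s)) :=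
    div_nonneg (by positivity) (by linarith)
  refine integrable_and_integral_le_of_lintegral_le ?_
    (fun y => mul_nonneg (by positivity) (hK.nonneg y)) (by positivity) ?_
  · exact ((by fun_prop : Continuous fun y : EuclideanSpace ℝ (Fin d) =>
      ‖y‖ ^ 2).aestronglyMeasurable.mul hK.aemeasurable.aestronglyMeasurable).restrict
  · have key := hK.lintegral_le_of_subset_iUnion hLam (p := 2) (by norm_num) (by positivity)
      (by norm_num) hq (ball_diff_subset_iUnion_annulus (d := d) (r := r))
    have heq : ∫⁻ y in ball (0 : EuclideanSpace ℝ (Fin d)) r, ENNReal.ofReal (‖y‖ ^ 2 * K y) =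
        ∫⁻ y in ball 0 r \ {0}, ENNReal.ofReal (‖y‖ ^ (2 : ℝ) * K y) := by
      rw [← lintegral_indicator measurableSet_ball,
        ← lintegral_indicator (measurableSet_ball.diff (measurableSet_singleton 0))]
      refine lintegral_congr fun y => ?_
      by_cases hy : y = 0
      · simp [hy]
      · simp [Set.indicator, hy]
    rw [heq]
    refine key.trans (ENNReal.ofReal_le_ofReal ?_)
    norm_num at hC ⊢
    gcongr <;> linarith

/-- The order `s` is a convenient choice below `2s`; it gives the ratio `2 ^ (-s)` and fixes the
tail growth allowed later. -/
theorem IsAdmissible.far_moment (hK : IsAdmissible d s lam Lam ρ K) (hLam : 0 < Lam)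
    (hs0 : 0 < s) {r : ℝ} (hr : 0 < r) :
    IntegrableOn (fun y => ‖y‖ ^ s * K y) (ball 0 r)ᶜ ∧
      ∫ y in (ball 0 r)ᶜ, ‖y‖ ^ s * K y ≤
        2 ^ s * Lam / (1 - (2 : ℝ) ^ (-s)) * r ^ (-s) := by
  have hq : (2 : ℝ) ^ (-s) < 1 := Real.rpow_lt_one_of_one_lt_of_neg (by norm_num) (by linarith)
  have hC : 0 ≤ 2 ^ s * Lam / (1 - (2 : ℝ) ^ (-s)) :=
    div_nonneg (by positivity) (by linarith)
  refine integrable_and_integral_le_of_lintegral_le ?_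
    (fun y => mul_nonneg (by positivity) (hK.nonneg y)) (by positivity) ?_
  · exact ((by fun_prop (disch := positivity) : Measurable fun y : EuclideanSpace ℝ (Fin d) =>
      ‖y‖ ^ s).aestronglyMeasurable.mul hK.aemeasurable.aestronglyMeasurable).restrict
  · have hexp : s - 2 * s = -s := by ring
    have key := hK.lintegral_le_of_subset_iUnion hLam hs0.le hr
      two_pos (by rwa [hexp]) (compl_ball_subset_iUnion_annulus (d := d) hr)
    rwa [hexp] at key

end IntegroDiff

/-! ### The operator at a single scale. -/

namespace IntegroDiff
open MeasureTheory Metric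
open scoped ENNReal

variable {d : ℕ} {s lam Lam ρ : ℝ} {K : EuclideanSpace ℝ (Fin d) → ℝ}

/-- Both `‖y‖` and `ρ` are at most `2r`, so the truncation is invisible at this scale. This is where
`ρ ≤ 2r` enters. -/
theorem IsAdmissible.le_of_norm_lt (hK : IsAdmissible d s lam Lam ρ K) (hlam : 0 < lam)
    (hs0 : 0 < s) (hρ : 0 < ρ) {r : ℝ} (hρr : ρ ≤ 2 * r) {y : EuclideanSpace ℝ (Fin d)}
    (hy0 : y ≠ 0) (hy : ‖y‖ < 2 * r) : lam * (2 * r) ^ (-(d : ℝ) - 2 * s) ≤ K y := by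
  refine le_trans (mul_le_mul_of_nonneg_left ?_ hlam.le) (hK.lower y hy0)
  have hexp : -(d : ℝ) - 2 * s ≤ 0 := by
    have : (0 : ℝ) ≤ d := d.cast_nonneg
    linarith
  rw [truncProfile, if_neg hρ.ne']
  exact le_min (Real.rpow_le_rpow_of_nonpos (norm_pos_iff.2 hy0) hy.le hexp)
    (Real.rpow_le_rpow_of_nonpos hρ hρr hexp)

theorem memLp_symm_difference {w : EuclideanSpace ℝ (Fin d) → ℝ} (hw : MemLp w ∞ volume)
    (x : EuclideanSpace ℝ (Fin d)) :
    MemLp (fun y => w (x + y) + w (x - y) - 2 * w x) ∞ volume :=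
  ((hw.comp_measurePreserving (measurePreserving_add_left volume x)).add
    (hw.comp_measurePreserving (Measure.measurePreserving_sub_left volume x))).sub
    (memLp_top_const _)

/-- If the second difference of `w` is at most a small quadratic near the origin plus a small
power far away, and at most `-1/2` more than this on a large set, then the operator is negative
at the scale `r`. -/
theorem exists_symOp_le (hs0 : 0 < s) (hs1 : s < 1) (hlam : 0 < lam) (hLam : 0 < Lam) :
    ∃ C₁ C₂ c₀ : ℝ, 0 < C₁ ∧ 0 < C₂ ∧ 0 < c₀ ∧
      ∀ (ρ r κ τ : ℝ) (K w : EuclideanSpace ℝ (Fin d) → ℝ) (x : EuclideanSpace ℝ (Fin d))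
        (G : Set (EuclideanSpace ℝ (Fin d))),
        0 < ρ → 0 < r → ρ ≤ 2 * r → K ∈ symKernels d s lam Lam ρ → MemLp w ∞ volume →
        0 ≤ κ → 0 ≤ τ → MeasurableSet G → G ⊆ ball 0 (2 * r) \ {0} →
        volume.real (ball (0 : EuclideanSpace ℝ (Fin d)) r) ≤ 2 * volume.real G →
        (∀ᵐ y, w (x + y) + w (x - y) - 2 * w x ≤
          2 * κ * (ball 0 (r / 4)).indicator (fun y => (‖y‖ / r) ^ 2) y +
          2 * τ * (ball 0 (r / 4))ᶜ.indicator (fun y => (4 * ‖y‖ / r) ^ s) y -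
          1 / 2 * G.indicator 1 y) →
        symOp K w x ≤ (2 * κ * C₁ + 2 * τ * C₂ - c₀) * r ^ (-(2 * s)) := by
  set ω : ℝ := volume.real (ball (0 : EuclideanSpace ℝ (Fin d)) 1) with hω
  have hω0 : 0 < ω := 
    ENNReal.toReal_pos (measure_ball_pos volume _ one_pos).ne' measure_ball_lt_top.ne
  have hq1 : (1 / 2 : ℝ) ^ (2 - 2 * s) < 1 :=
    Real.rpow_lt_one (by norm_num) (by norm_num) (by linarith)
  have hq2 : (2 : ℝ) ^ (-s) < 1 := Real.rpow_lt_one_of_one_lt_of_neg (by norm_num) (by linarith)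
  set N : ℝ := 2 ^ 2 * Lam / (1 - (1 / 2 : ℝ) ^ (2 - 2 * s)) with hN
  set F : ℝ := 2 ^ s * Lam / (1 - (2 : ℝ) ^ (-s)) with hF
  have hN0 : 0 < N := div_pos (by positivity) (by linarith)
  have hF0 : 0 < F := div_pos (by positivity) (by linarith)
  -- The first two constants are the moments for radius `r / 4` with the powers of `r` removed. The
  -- `1/4` in `c₀` is the coefficient `1/2` of the indicator times the half of the ball's measure
  -- filled by `G`.
  refine ⟨N * (1 / 4) ^ (2 - 2 * s), F * 4 ^ s * (1 / 4) ^ (-s),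
    lam * 2 ^ (-(d : ℝ) - 2 * s) * ω / 4, by positivity, by positivity, by positivity, ?_⟩
  intro ρ r κ τ K w x G hρ hr hρr hKS hw hκ hτ hGm hG hGvol hD
  obtain ⟨hK, hKint, -⟩ := hKS
  have hr4 : 0 < r / 4 := by positivity
  obtain ⟨hN1, hN2⟩ := hK.near_moment hLam hs1 hr4
  obtain ⟨hF1, hF2⟩ := hK.far_moment hLam hs0 hr4
  rw [← hN] at hN2
  rw [← hF] at hF2
  have hN3 := hN1.integrable_indicator measurableSet_ball
  have hF3 := hF1.integrable_indicator measurableSet_ball.compl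
  have hG3 := hKint.indicator hGm
  rw [← integral_indicator measurableSet_ball] at hN2
  rw [← integral_indicator measurableSet_ball.compl] at hF2
  have hGfin : volume G ≠ ∞ :=
    ((measure_mono (hG.trans Set.sdiff_subset)).trans_lt measure_ball_lt_top).ne
  have hG2 : lam * 2 ^ (-(d : ℝ) - 2 * s) * ω / 2 * r ^ (-(2 * s)) ≤ ∫ y, G.indicator K y := by
    rw [integral_indicator hGm]
    have h1 : volume.real G • (lam * (2 * r) ^ (-(d : ℝ) - 2 * s)) ≤ ∫ y in G, K y :=
      setIntegral_ge_of_const_le hGm hGfin (fun y hy => hK.le_of_norm_lt hlam hs0 hρ hρr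
        (hG hy).2 (mem_ball_zero_iff.1 (hG hy).1)) hKint.integrableOn
    have h2 : volume.real (ball (0 : EuclideanSpace ℝ (Fin d)) r) = r ^ (d : ℝ) * ω := by
      rw [measureReal_def, Measure.addHaar_ball_of_pos _ _ hr, ENNReal.toReal_mul,
        ENNReal.toReal_ofReal (by positivity), finrank_euclideanSpace_fin, Real.rpow_natCast,
        hω, measureReal_def]
    rw [h2] at hGvol
    refine le_trans ?_ h1
    have h3 : lam * 2 ^ (-(d : ℝ) - 2 * s) * ω / 2 * r ^ (-(2 * s)) =
        (r ^ (d : ℝ) * ω) / 2 * (lam * (2 * r) ^ (-(d : ℝ) - 2 * s)) := by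
      rw [Real.mul_rpow two_pos.le hr.le,
        show -(2 * s) = (d : ℝ) + (-(d : ℝ) - 2 * s) by ring, Real.rpow_add hr]
      ring
    rw [h3, smul_eq_mul]
    gcongr
    linarith
  have hbound : ∀ᵐ y, (w (x + y) + w (x - y) - 2 * w x) * K y ≤
      2 * κ / r ^ 2 * (ball 0 (r / 4)).indicator (fun y => ‖y‖ ^ 2 * K y) y +
      2 * τ * (4 / r) ^ s * (ball 0 (r / 4))ᶜ.indicator (fun y => ‖y‖ ^ s * K y) y -
      1 / 2 * G.indicator K y := by
    filter_upwards [hD] with y hy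
    refine (mul_le_mul_of_nonneg_right hy (hK.nonneg y)).trans_eq ?_
    have e1 : (4 * ‖y‖ / r) ^ s = (4 / r) ^ s * ‖y‖ ^ s := by
      rw [← Real.mul_rpow (by positivity) (norm_nonneg y)]
      ring_nf
    classical
    simp only [Set.indicator_apply, Pi.one_apply, e1]
    split_ifs <;> ring
  have hDint : Integrable (fun y => (w (x + y) + w (x - y) - 2 * w x) * K y) :=
    hKint.mul_of_top_right (memLp_symm_difference hw x)
  have hint := integral_mono_ae hDint
    (((hN3.const_mul (2 * κ / r ^ 2)).add (hF3.const_mul (2 * τ * (4 / r) ^ s))).sub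
      (hG3.const_mul (1 / 2))) hbound
  rw [integral_sub' ((hN3.const_mul (2 * κ / r ^ 2)).add (hF3.const_mul (2 * τ * (4 / r) ^ s)))
      (hG3.const_mul (1 / 2)),
    integral_add' (hN3.const_mul (2 * κ / r ^ 2)) (hF3.const_mul (2 * τ * (4 / r) ^ s)),
    integral_const_mul, integral_const_mul, integral_const_mul] at hint
  refine hint.trans ?_
  have e2 : 2 * κ / r ^ 2 * (N * (r / 4) ^ (2 - 2 * s)) =
      2 * κ * (N * (1 / 4) ^ (2 - 2 * s)) * r ^ (-(2 * s)) := by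
    rw [show r / 4 = r * (1 / 4) by ring, Real.mul_rpow hr.le (by norm_num),
      show r ^ (2 - 2 * s) = r ^ 2 * r ^ (-(2 * s)) by
        rw [sub_eq_add_neg, Real.rpow_add hr]; norm_num]
    field_simp
  have e3 : 2 * τ * (4 / r) ^ s * (F * (r / 4) ^ (-s)) =
      2 * τ * (F * 4 ^ s * (1 / 4) ^ (-s)) * r ^ (-(2 * s)) := by
    rw [show r / 4 = r * (1 / 4) by ring, Real.mul_rpow hr.le (by norm_num),
      show -(2 * s) = -s + -s by ring, Real.rpow_add hr, Real.div_rpow (by norm_num) hr.le,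
      Real.rpow_neg hr.le]
    ring
  have i1 := mul_le_mul_of_nonneg_left hN2 (by positivity : 0 ≤ 2 * κ / r ^ 2)
  have i2 := mul_le_mul_of_nonneg_left hF2 (by positivity : 0 ≤ 2 * τ * (4 / r) ^ s)
  rw [e2] at i1
  rw [e3] at i2
  linarith

end IntegroDiff

/-! ### Touching by a paraboloid and improvement of the maximum. -/

namespace IntegroDiff
open MeasureTheory Metric
open scoped ENNReal RealInnerProductSpace

variable {d : ℕ} {s lam Lam ρ : ℝ}

/-- One-sided increments of `w` at a maximum point `x₁` of `w - κ ‖· - x₀‖² / r²`. -/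
theorem increment_le {w : EuclideanSpace ℝ (Fin d) → ℝ} {x₀ x₁ y : EuclideanSpace ℝ (Fin d)}
    {r κ τ : ℝ} (hs0 : 0 < s) (hr : 0 < r) (hκ0 : 0 ≤ κ) (hκ : κ ≤ 1 / 2) (hτ : 0 ≤ τ)
    (hx₁ : ‖x₁ - x₀‖ < 3 * r / 4) (hwx₁ : 1 - κ / 2 ≤ w x₁)
    (hmax : ∀ z ∈ ball x₀ r, w z - κ * (‖z - x₀‖ / r) ^ 2 ≤ w x₁ - κ * (‖x₁ - x₀‖ / r) ^ 2)
    (hle : ∀ z ∈ ball x₀ r, w z ≤ 1)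
    (htail : x₁ + y ∉ ball x₀ r → w (x₁ + y) ≤ 1 + τ * (‖x₁ + y - x₀‖ / r) ^ s) :
    w (x₁ + y) - w x₁ ≤
      κ * (ball 0 (r / 4)).indicator
        (fun y => (‖y‖ / r) ^ 2 + 2 * ⟪x₁ - x₀, y⟫ / r ^ 2) y +
      (κ + τ) * (ball 0 (r / 4))ᶜ.indicator (fun y => (4 * ‖y‖ / r) ^ s) y -
      1 / 2 * {z ∈ ball x₀ r | w z ≤ 0}.indicator 1 (x₁ + y) := by
  have hsub : x₁ + y - x₀ = (x₁ - x₀) + y := by abel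
  have htri : ‖x₁ + y - x₀‖ ≤ ‖x₁ - x₀‖ + ‖y‖ := by
    rw [hsub]
    exact norm_add_le _ _
  by_cases hy : y ∈ ball (0 : EuclideanSpace ℝ (Fin d)) (r / 4)
  · have hyr := mem_ball_zero_iff.1 hy
    have hz : x₁ + y ∈ ball x₀ r := by
      rw [mem_ball_iff_norm]
      linarith
    have hexp : (‖x₁ + y - x₀‖ / r) ^ 2 =
        (‖x₁ - x₀‖ / r) ^ 2 + ((‖y‖ / r) ^ 2 + 2 * ⟪x₁ - x₀, y⟫ / r ^ 2) := by
      rw [hsub, div_pow, norm_add_sq_real]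
      field_simp
      ring
    have h1 := hmax _ hz
    rw [hexp] at h1
    rw [Set.indicator_of_mem hy, Set.indicator_of_notMem (by simpa using hy)]
    by_cases hG : x₁ + y ∈ {z ∈ ball x₀ r | w z ≤ 0}
    · rw [Set.indicator_of_mem hG, Pi.one_apply]
      have h2 := hG.2
      -- On `G` the bound comes from the drop of `w`, not from maximality, so the linear term must
      -- be bounded below. It costs at most `3κ/8`, and the drop `1 - κ/2` leaves room since `7κ/8 ≤
      -- 1/2`.
      have h3 : -(3 / 16 : ℝ) ≤ ⟪x₁ - x₀, y⟫ / r ^ 2 := by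
        rw [le_div_iff₀ (by positivity)]
        have h4 := neg_le_of_abs_le (abs_real_inner_le_norm (x₁ - x₀) y)
        have h5 : ‖x₁ - x₀‖ * ‖y‖ ≤ (3 * r / 4) * (r / 4) := by gcongr
        nlinarith
      have h6 : κ * (-(3 / 8 : ℝ)) ≤ κ * ((‖y‖ / r) ^ 2 + 2 * ⟪x₁ - x₀, y⟫ / r ^ 2) := by
        refine mul_le_mul_of_nonneg_left ?_ hκ0
        have : 0 ≤ (‖y‖ / r) ^ 2 := by positivity
        rw [mul_div_assoc]
        linarith
      linarith
    · rw [Set.indicator_of_notMem hG]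
      linarith
  · have hyr : r / 4 ≤ ‖y‖ := by simpa using hy
    have hone : 1 ≤ 4 * ‖y‖ / r := by
      rw [one_le_div hr]
      linarith
    have hpow : 1 ≤ (4 * ‖y‖ / r) ^ s := Real.one_le_rpow hone hs0.le
    rw [Set.indicator_of_notMem hy, Set.indicator_of_mem (by simpa using hy)]
    have h1 : κ ≤ κ * (4 * ‖y‖ / r) ^ s := le_mul_of_one_le_right hκ0 hpow
    have h2 : 0 ≤ τ * (4 * ‖y‖ / r) ^ s := by positivity
    by_cases hz : x₁ + y ∈ ball x₀ r
    · by_cases hG : x₁ + y ∈ {z ∈ ball x₀ r | w z ≤ 0}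
      · rw [Set.indicator_of_mem hG, Pi.one_apply]
        have := hG.2
        linarith
      · rw [Set.indicator_of_notMem hG]
        have := hle _ hz
        linarith
    · rw [Set.indicator_of_notMem (fun h => hz h.1)]
      -- The factor `4` comes from `‖x₁ + y - x₀‖ ≤ 3r/4 + ‖y‖ ≤ 4‖y‖`.
      have h3 : τ * (‖x₁ + y - x₀‖ / r) ^ s ≤ τ * (4 * ‖y‖ / r) ^ s := by
        gcongr
        linarith
      have := htail hz
      linarith

/-- Improvement of the maximum at one scale. -/
theorem exists_improvement (d : ℕ) (hs0 : 0 < s) (hs1 : s < 1) (hlam : 0 < lam)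
    (hLam : 0 < Lam) :
    ∃ θ τ η : ℝ, 0 < θ ∧ 0 < τ ∧ 0 < η ∧
      ∀ (ρ r : ℝ) (w : EuclideanSpace ℝ (Fin d) → ℝ) (x₀ : EuclideanSpace ℝ (Fin d)),
        0 < ρ → 0 < r → ρ ≤ 2 * r → MemLp w ∞ volume → ContinuousOn w (ball x₀ r) →
        (∀ x ∈ ball x₀ r, w x ≤ 1) →
        (∀ᵐ x, x ∉ ball x₀ r → w x ≤ 1 + τ * (‖x - x₀‖ / r) ^ s) →
        volume.real (ball x₀ r) ≤ 2 * volume.real {x ∈ ball x₀ r | w x ≤ 0} →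
        (∀ x ∈ ball x₀ r, ∃ K ∈ symKernels d s lam Lam ρ, -η * r ^ (-(2 * s)) < symOp K w x) →
        ∀ x ∈ ball x₀ (r / 2), w x ≤ 1 - θ := by
  obtain ⟨C₁, C₂, c₀, hC₁, hC₂, hc₀, H⟩ := exists_symOp_le (d := d) hs0 hs1 hlam hLam
  set κ : ℝ := min (1 / 2) (c₀ / (8 * (C₁ + C₂))) with hκdef
  have hκ0 : 0 < κ := lt_min (by norm_num) (by positivity)
  have hκ : κ ≤ 1 / 2 := min_le_left _ _
  have hκC : κ * (C₁ + C₂) ≤ c₀ / 8 := by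
    have h : κ ≤ c₀ / (8 * (C₁ + C₂)) := min_le_right _ _
    rw [le_div_iff₀ (by positivity)] at h
    linarith
  -- With `θ = κ/4`, a bad point of the half ball has penalized value above `1 - κ/2`, whereas
  -- beyond `3r/4` that value is at most `1 - 9κ/16`; so the maximum is interior. The other choices
  -- make `2κC₁ + 2(κ + τ)C₂ - c₀ ≤ -c₀/2 = -η`.
  refine ⟨κ / 4, c₀ / (8 * C₂), c₀ / 2, by positivity, by positivity, by positivity, ?_⟩
  intro ρ r w x₀ hρ hr hρr hw hcont hle htail hvol heq x hx
  by_contra! hlt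
  set τ : ℝ := c₀ / (8 * C₂) with hτdef
  have hτ : 0 < τ := by positivity
  have hτC : τ * C₂ = c₀ / 8 := by
    rw [hτdef]
    field_simp
  have hsub : closedBall x₀ (3 * r / 4) ⊆ ball x₀ r := closedBall_subset_ball (by linarith)
  have hxin : x ∈ closedBall x₀ (3 * r / 4) :=
    ball_subset_closedBall (ball_subset_ball (by linarith) hx)
  obtain ⟨x₁, hx₁, hmax'⟩ := (isCompact_closedBall x₀ (3 * r / 4)).exists_isMaxOn ⟨x, hxin⟩
    (f := fun z => w z - κ * (‖z - x₀‖ / r) ^ 2)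
    ((hcont.mono hsub).sub (by fun_prop))
  rw [isMaxOn_iff] at hmax'
  have hx' : w x - κ * (‖x - x₀‖ / r) ^ 2 ≤ w x₁ - κ * (‖x₁ - x₀‖ / r) ^ 2 := hmax' x hxin
  have hxq : κ * (‖x - x₀‖ / r) ^ 2 ≤ κ * (1 / 2) ^ 2 := by
    have h1 : ‖x - x₀‖ / r ≤ 1 / 2 := by
      rw [mem_ball_iff_norm] at hx
      rw [div_le_iff₀ hr]
      linarith
    exact mul_le_mul_of_nonneg_left (pow_le_pow_left₀ (by positivity) h1 2) hκ0.le
  have hfar : ∀ z ∈ ball x₀ r, 3 * r / 4 ≤ ‖z - x₀‖ →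
      w z - κ * (‖z - x₀‖ / r) ^ 2 < w x₁ - κ * (‖x₁ - x₀‖ / r) ^ 2 := by
    intro z hz hzn
    have h1 : κ * (3 / 4) ^ 2 ≤ κ * (‖z - x₀‖ / r) ^ 2 := by
      have h2 : 3 / 4 ≤ ‖z - x₀‖ / r := by
        rw [le_div_iff₀ hr]
        linarith
      exact mul_le_mul_of_nonneg_left (pow_le_pow_left₀ (by norm_num) h2 2) hκ0.le
    have := hle z hz
    linarith
  have hx₁n : ‖x₁ - x₀‖ < 3 * r / 4 := by
    by_contra! h
    exact lt_irrefl _ (hfar x₁ (hsub hx₁) h)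
  have hmax : ∀ z ∈ ball x₀ r,
      w z - κ * (‖z - x₀‖ / r) ^ 2 ≤ w x₁ - κ * (‖x₁ - x₀‖ / r) ^ 2 := by
    intro z hz
    by_cases h : z ∈ closedBall x₀ (3 * r / 4)
    · exact hmax' z h
    · rw [mem_closedBall_iff_norm, not_le] at h
      exact (hfar z hz h.le).le
  have hwx₁ : 1 - κ / 2 ≤ w x₁ := by
    have : 0 ≤ κ * (‖x₁ - x₀‖ / r) ^ 2 := by positivity
    linarith
  obtain ⟨K, hK, hKlt⟩ := heq x₁ (hsub hx₁)
  set G : Set (EuclideanSpace ℝ (Fin d)) := {z ∈ ball x₀ r | w z ≤ 0} with hGdef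
  have hGm : MeasurableSet G := by
    have hopen : IsOpen (ball x₀ r ∩ w ⁻¹' Set.Ioi 0) :=
      hcont.isOpen_inter_preimage isOpen_ball isOpen_Ioi
    have hG' : G = ball x₀ r \ (ball x₀ r ∩ w ⁻¹' Set.Ioi 0) := by
      ext z
      simp only [hGdef, Set.mem_ofPred_eq, Set.mem_sdiff, Set.mem_inter_iff, Set.mem_preimage,
        Set.mem_Ioi, not_and, not_lt]
      tauto
    rw [hG']
    exact measurableSet_ball.diff hopen.measurableSet
  have hpres := measurePreserving_add_left (volume : Measure (EuclideanSpace ℝ (Fin d))) x₁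
  have hpres' := Measure.measurePreserving_sub_left
    (volume : Measure (EuclideanSpace ℝ (Fin d))) x₁
  have hGvol : volume.real ((fun y => x₁ + y) ⁻¹' G) = volume.real G := by
    rw [measureReal_def, hpres.measure_preimage hGm.nullMeasurableSet, measureReal_def]
  have hballvol : volume.real (ball (0 : EuclideanSpace ℝ (Fin d)) r) =
      volume.real (ball x₀ r) :=
    congrArg ENNReal.toReal (Measure.addHaar_ball_center volume x₀ r).symm
  have hbd := H ρ r κ (κ + τ) K w x₁ ((fun y => x₁ + y) ⁻¹' G) hρ hr hρr hK hw hκ0.le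
    (by positivity) (hpres.measurable hGm) ?_ (by rw [hGvol, hballvol]; exact hvol) ?_
  · have h1 : (2 * κ * C₁ + 2 * (κ + τ) * C₂ - c₀) * r ^ (-(2 * s)) ≤
        -(c₀ / 2) * r ^ (-(2 * s)) := by
      refine mul_le_mul_of_nonneg_right ?_ (by positivity)
      linarith
    linarith
  · intro y hy
    refine ⟨?_, ?_⟩
    · have h1 := mem_ball_iff_norm.1 hy.1
      rw [mem_ball_zero_iff]
      calc ‖y‖ = ‖(x₁ + y - x₀) - (x₁ - x₀)‖ := by congr 1; abel
        _ ≤ ‖x₁ + y - x₀‖ + ‖x₁ - x₀‖ := norm_sub_le _ _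
        _ < 2 * r := by linarith
    · rintro rfl
      have h2 : w (x₁ + 0) ≤ 0 := hy.2
      rw [add_zero] at h2
      linarith
  · filter_upwards [hpres.quasiMeasurePreserving.ae htail,
      hpres'.quasiMeasurePreserving.ae htail] with y h1 h2
    have i1 := increment_le hs0 hr hκ0.le hκ hτ.le hx₁n hwx₁ hmax hle h1
    have i2 := increment_le (y := -y) hs0 hr hκ0.le hκ hτ.le hx₁n hwx₁ hmax hle
      (by rwa [← sub_eq_add_neg])
    have h3 : 0 ≤ G.indicator (1 : EuclideanSpace ℝ (Fin d) → ℝ) (x₁ + -y) :=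
      Set.indicator_nonneg (fun _ _ => zero_le_one) _
    have h4 : ((fun y => x₁ + y) ⁻¹' G).indicator (1 : EuclideanSpace ℝ (Fin d) → ℝ) y =
        G.indicator 1 (x₁ + y) := rfl
    rw [h4]
    rw [← hGdef] at i1 i2
    rw [← sub_eq_add_neg] at i2 h3
    -- The linear terms cancel pointwise between `y` and `-y`.
    have h5 : κ * (ball 0 (r / 4)).indicator
          (fun y => (‖y‖ / r) ^ 2 + 2 * ⟪x₁ - x₀, y⟫ / r ^ 2) y +
        κ * (ball 0 (r / 4)).indicator
          (fun y => (‖y‖ / r) ^ 2 + 2 * ⟪x₁ - x₀, y⟫ / r ^ 2) (-y) =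
        2 * κ * (ball 0 (r / 4)).indicator (fun y => (‖y‖ / r) ^ 2) y := by
      classical
      simp only [Set.indicator_apply, mem_ball_zero_iff, norm_neg, inner_neg_right]
      split_ifs <;> ring
    have h6 : (ball (0 : EuclideanSpace ℝ (Fin d)) (r / 4))ᶜ.indicator
          (fun y => (4 * ‖y‖ / r) ^ s) (-y) =
        (ball 0 (r / 4))ᶜ.indicator (fun y => (4 * ‖y‖ / r) ^ s) y := by
      classical
      simp only [Set.indicator_apply, Set.mem_compl_iff, mem_ball_zero_iff, norm_neg]
    rw [h6] at i2
    linarith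

end IntegroDiff

/-! ### Decay of oscillation under halving of the radius. -/

namespace IntegroDiff
open MeasureTheory Metric
open scoped ENNReal

variable {d : ℕ} {s lam Lam ρ α r m h : ℝ} {u : EuclideanSpace ℝ (Fin d) → ℝ}
  {x₀ : EuclideanSpace ℝ (Fin d)}

/-- `u` differs from `m` by at most `h` on `B_r(x₀)`, and this bound grows like a power of order
`α` outside of this ball. -/
def OscBound (α : ℝ) (u : EuclideanSpace ℝ (Fin d) → ℝ) (x₀ : EuclideanSpace ℝ (Fin d))
    (r m h : ℝ) : Prop :=
  (∀ x ∈ ball x₀ r, |u x - m| ≤ h) ∧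
    ∀ᵐ x, x ∉ ball x₀ r → |u x - m| ≤ h * (2 * (2 * ‖x - x₀‖ / r) ^ α - 1)

theorem OscBound.neg (hu : OscBound α u x₀ r m h) : OscBound α (-u) x₀ r (-m) h := by
  have hab : ∀ x, |(-u) x - -m| = |u x - m| := fun x => by
    rw [← abs_neg, Pi.neg_apply]
    ring_nf
  simpa only [OscBound, hab] using hu

/-- `sup_K` of the operators is at least `-A`, in terms of near-maximizers. -/
def IsSymSub (s lam Lam ρ A : ℝ) (u : EuclideanSpace ℝ (Fin d) → ℝ)
    (U : Set (EuclideanSpace ℝ (Fin d))) : Prop :=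
  ∀ x ∈ U, ∀ B, A < B → ∃ K ∈ symKernels d s lam Lam ρ, -B < symOp K u x

theorem isSymSub_of_le_symSup {A : ℝ} {U : Set (EuclideanSpace ℝ (Fin d))}
    (hu : ∀ x ∈ U, ((-A : ℝ) : EReal) ≤ symSup s lam Lam ρ u x) :
    IsSymSub s lam Lam ρ A u U := by
  intro x hx B hB
  have hlt : ((-B : ℝ) : EReal) < symSup s lam Lam ρ u x :=
    lt_of_lt_of_le (EReal.coe_lt_coe_iff.2 (neg_lt_neg hB)) (hu x hx)
  simp only [symSup, lt_iSup_iff] at hlt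
  obtain ⟨K, hK, hlt⟩ := hlt
  exact ⟨K, hK, EReal.coe_lt_coe_iff.1 hlt⟩

theorem symOp_affine (K u : EuclideanSpace ℝ (Fin d) → ℝ) (c m : ℝ)
    (x : EuclideanSpace ℝ (Fin d)) :
    symOp K (fun x => c * (u x - m)) x = c * symOp K u x := by
  rw [symOp, symOp, ← integral_const_mul]
  refine integral_congr_ae (Filter.Eventually.of_forall fun y => ?_)
  ring

theorem symOp_neg (K u : EuclideanSpace ℝ (Fin d) → ℝ) (x : EuclideanSpace ℝ (Fin d)) :
    symOp K (-u) x = -symOp K u x := by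
  rw [symOp, symOp, ← integral_neg]
  refine integral_congr_ae (Filter.Eventually.of_forall fun y => ?_)
  simp only [Pi.neg_apply]
  ring

theorem isSymSub_neg_of_symInf_le {A : ℝ} {U : Set (EuclideanSpace ℝ (Fin d))}
    (hu : ∀ x ∈ U, symInf s lam Lam ρ u x ≤ ((A : ℝ) : EReal)) :
    IsSymSub s lam Lam ρ A (-u) U := by
  intro x hx B hB
  have hlt : symInf s lam Lam ρ u x < ((B : ℝ) : EReal) :=
    lt_of_le_of_lt (hu x hx) (EReal.coe_lt_coe_iff.2 hB)
  simp only [symInf, iInf_lt_iff] at hlt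
  obtain ⟨K, hK, hlt⟩ := hlt
  refine ⟨K, hK, ?_⟩
  rw [symOp_neg]
  exact neg_lt_neg (EReal.coe_lt_coe_iff.1 hlt)

/-- Bernoulli's inequality with exponent `α / s ≤ 1`, applied to `(2t) ^ s`, produces the small
factor `α / s`. Thus for small `α` the tail in `OscBound` is admissible in `exists_improvement`. -/
theorem rpow_growth_le {s α τ t : ℝ} (hs0 : 0 < s) (hs1 : s < 1) (hα0 : 0 ≤ α) (hαs : α ≤ s)
    (hατ : 4 * α / s ≤ τ) (ht : 1 ≤ t) : 2 * (2 * t) ^ α - 1 ≤ 1 + τ * t ^ s := by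
  have ht0 : 0 < t := by linarith
  have h1 : (2 * t) ^ α = (1 + ((2 * t) ^ s - 1)) ^ (α / s) := by
    rw [add_sub_cancel, ← Real.rpow_mul (by positivity), mul_div_cancel₀ _ hs0.ne']
  have h2 : (2 * t) ^ α ≤ 1 + α / s * ((2 * t) ^ s - 1) := by
    rw [h1]
    refine rpow_one_add_le_one_add_mul_self ?_ (by positivity) ((div_le_one hs0).2 hαs)
    have : 0 ≤ (2 * t) ^ s := by positivity
    linarith
  have h3 : (2 * t) ^ s ≤ 2 * t ^ s := by
    rw [Real.mul_rpow two_pos.le ht0.le]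
    gcongr
    calc (2 : ℝ) ^ s ≤ 2 ^ (1 : ℝ) := Real.rpow_le_rpow_of_exponent_le (by norm_num) hs1.le
      _ = 2 := Real.rpow_one 2
  have h4 : α / s * ((2 * t) ^ s - 1) ≤ α / s * (2 * t ^ s) :=
    mul_le_mul_of_nonneg_left (by linarith) (by positivity)
  have h5 : 4 * α / s * t ^ s ≤ τ * t ^ s := by gcongr
  have h6 : 4 * α / s * t ^ s = 2 * (α / s * (2 * t ^ s)) := by ring
  linarith

/-- An upper bound that improves on the half ball gives an oscillation bound there. -/
theorem OscBound.half (hu : OscBound α u x₀ r m h) (hα : 0 ≤ α) (hr : 0 < r) (hh : 0 < h)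
    (hup : ∀ x ∈ ball x₀ (r / 2), u x - m ≤ h * (1 - 2 * (1 - 2 ^ (-α)))) :
    OscBound α u x₀ (r / 2) (m - (1 - 2 ^ (-α)) * h) (2 ^ (-α) * h) := by
  have hq0 : 0 < (2 : ℝ) ^ (-α) := by positivity
  have hq1 : (2 : ℝ) ^ (-α) ≤ 1 := Real.rpow_le_one_of_one_le_of_nonpos (by norm_num) (by linarith)
  have hqq : (2 : ℝ) ^ (-α) * 2 ^ α = 1 := by
    rw [← Real.rpow_add two_pos, neg_add_cancel, Real.rpow_zero]
  set q : ℝ := 2 ^ (-α) with hq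
  have hqh : 0 ≤ (1 - q) * h := mul_nonneg (by linarith) hh.le
  -- The profile is invariant under the recentring: `h(2X - 1) + (1 - q)h = qh(2 · 2 ^ α X - 1)`
  -- because `q 2 ^ α = 1`.
  have hfar : ∀ x, |u x - m| ≤ h * (2 * (2 * ‖x - x₀‖ / r) ^ α - 1) →
      |u x - (m - (1 - q) * h)| ≤ q * h * (2 * (2 * ‖x - x₀‖ / (r / 2)) ^ α - 1) := by
    intro x hx
    have e : (2 * ‖x - x₀‖ / (r / 2)) ^ α = 2 ^ α * (2 * ‖x - x₀‖ / r) ^ α := by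
      rw [← Real.mul_rpow two_pos.le (by positivity)]
      congr 1
      field_simp
    have e2 : q * h * (2 * (2 ^ α * (2 * ‖x - x₀‖ / r) ^ α) - 1) =
        (q * 2 ^ α) * h * (2 * (2 * ‖x - x₀‖ / r) ^ α) - q * h := by ring
    rw [e, e2, hqq]
    rw [abs_le] at hx ⊢
    constructor <;> linarith [hx.1, hx.2]
  refine ⟨fun x hx => ?_, ?_⟩
  · have h1 := hu.1 x (ball_subset_ball (by linarith) hx)
    have h2 := hup x hx
    rw [abs_le] at h1 ⊢
    constructor <;> linarith [h1.1]
  · filter_upwards [hu.2] with x hx hxn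
    by_cases hxr : x ∈ ball x₀ r
    · have h1 := hu.1 x hxr
      rw [mem_ball_iff_norm, not_lt] at hxn
      have h2 : (2 : ℝ) ^ α ≤ (2 * ‖x - x₀‖ / (r / 2)) ^ α := by
        refine Real.rpow_le_rpow two_pos.le ?_ hα
        rw [le_div_iff₀ (by positivity)]
        linarith
      -- On `B_r \ B_{r/2}` the recentred bound `h + (1 - q)h` equals this left-hand side exactly.
      have h3 : q * h * (2 * 2 ^ α - 1) ≤ q * h * (2 * (2 * ‖x - x₀‖ / (r / 2)) ^ α - 1) :=
        mul_le_mul_of_nonneg_left (by linarith) (by positivity)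
      have h4 : q * h * (2 * 2 ^ α - 1) = (q * 2 ^ α) * h * 2 - q * h := by ring
      rw [h4, hqq] at h3
      refine le_trans ?_ h3
      rw [abs_le] at h1 ⊢
      constructor <;> linarith [h1.1, h1.2]
    · exact hfar x (hx hxr)

/-- Decay of the oscillation from one dyadic scale to the next. -/
theorem exists_osc_decay (d : ℕ) (hs0 : 0 < s) (hs1 : s < 1) (hlam : 0 < lam)
    (hLam : 0 < Lam) :
    ∃ α η : ℝ, 0 < α ∧ α < 2 * s ∧ 0 < η ∧
      ∀ (ρ r A m h : ℝ) (u : EuclideanSpace ℝ (Fin d) → ℝ) (x₀ : EuclideanSpace ℝ (Fin d)),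
        0 < ρ → 0 < r → ρ ≤ 2 * r → 0 < h → MemLp u ∞ volume → ContinuousOn u (ball x₀ r) →
        IsSymSub s lam Lam ρ A u (ball x₀ r) → IsSymSub s lam Lam ρ A (-u) (ball x₀ r) →
        A < h * (η * r ^ (-(2 * s))) → OscBound α u x₀ r m h →
        ∃ m', OscBound α u x₀ (r / 2) m' (2 ^ (-α) * h) := by
  obtain ⟨θ, τ, η, hθ, hτ, hη, H⟩ := exists_improvement d hs0 hs1 hlam hLam
  -- The three bounds serve `2(1 - 2 ^ (-α)) ≤ θ`, the tail coefficient `4α/s ≤ τ`, and `α ≤ s`,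
  -- which allows Bernoulli and gives `α < 2s`.
  set α : ℝ := min (θ / 2) (min (s * τ / 4) s) with hα
  have hα0 : 0 < α := by positivity
  have hαs : α ≤ s := (min_le_right _ _).trans (min_le_right _ _)
  have hατ : 4 * α / s ≤ τ := by
    have h1 : α ≤ s * τ / 4 := (min_le_right _ _).trans (min_le_left _ _)
    rw [div_le_iff₀ hs0]
    linarith
  have hαθ : 2 * (1 - 2 ^ (-α)) ≤ θ := by
    have h1 : α ≤ θ / 2 := min_le_left _ _
    have h2 : 1 - α ≤ (2 : ℝ) ^ (-α) := by
      rw [Real.rpow_def_of_pos two_pos]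
      have h3 := Real.add_one_le_exp (Real.log 2 * -α)
      have h4 : Real.log 2 * α ≤ 1 * α :=
        mul_le_mul_of_nonneg_right (by linarith [Real.log_two_lt_d9]) hα0.le
      linarith
    linarith
  have upper : ∀ (ρ r A m h : ℝ) (u : EuclideanSpace ℝ (Fin d) → ℝ)
      (x₀ : EuclideanSpace ℝ (Fin d)),
      0 < ρ → 0 < r → ρ ≤ 2 * r → 0 < h → MemLp u ∞ volume → ContinuousOn u (ball x₀ r) →
      IsSymSub s lam Lam ρ A u (ball x₀ r) →
      A < h * (η * r ^ (-(2 * s))) → OscBound α u x₀ r m h →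
      volume.real (ball x₀ r) ≤ 2 * volume.real {x ∈ ball x₀ r | u x ≤ m} →
      ∃ m', OscBound α u x₀ (r / 2) m' (2 ^ (-α) * h) := by
    intro ρ r A m h u x₀ hρ hr hρr hh hu hcont hsub hA hosc hvol
    have key := H ρ r (fun x => h⁻¹ * (u x - m)) x₀ hρ hr hρr
      ((hu.sub (memLp_top_const m)).const_mul h⁻¹)
      (continuousOn_const.mul (hcont.sub continuousOn_const)) ?_ ?_ ?_ ?_
    · refine ⟨_, hosc.half hα0.le hr hh fun x hx => ?_⟩
      have h1 := key x hx
      rw [inv_mul_le_iff₀ hh] at h1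
      refine h1.trans (mul_le_mul_of_nonneg_left (by linarith) hh.le)
    · intro x hx
      rw [inv_mul_le_iff₀ hh, mul_one]
      exact (le_abs_self _).trans (hosc.1 x hx)
    · filter_upwards [hosc.2] with x hx hxn
      rw [inv_mul_le_iff₀ hh]
      refine ((le_abs_self _).trans (hx hxn)).trans (mul_le_mul_of_nonneg_left ?_ hh.le)
      rw [mem_ball_iff_norm, not_lt] at hxn
      have := rpow_growth_le hs0 hs1 hα0.le hαs hατ ((one_le_div hr).2 hxn)
      rwa [← mul_div_assoc] at this
    · refine hvol.trans_eq ?_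
      congr 3
      ext x
      have hiff : h⁻¹ * (u x - m) ≤ 0 ↔ u x ≤ m := by
        rw [inv_mul_le_iff₀ hh, mul_zero, sub_nonpos]
      simp only [hiff]
    · intro x hx
      obtain ⟨K, hK, hlt⟩ := hsub x hx _ hA
      refine ⟨K, hK, ?_⟩
      rw [symOp_affine, lt_inv_mul_iff₀ hh]
      linarith
  refine ⟨α, η, hα0, by linarith, hη, ?_⟩
  intro ρ r A m h u x₀ hρ hr hρr hh hu hcont hsub hsub' hA hosc
  have hfin : ∀ p : EuclideanSpace ℝ (Fin d) → Prop, volume {x ∈ ball x₀ r | p x} ≠ ∞ :=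
    fun p => ((measure_mono (Set.sep_subset _ _)).trans_lt measure_ball_lt_top).ne
  -- One of `u ≤ m` and `u ≥ m` fills half of the ball; the second case is the first for `-u`.
  have hsplit : volume.real (ball x₀ r) ≤
      volume.real {x ∈ ball x₀ r | u x ≤ m} + volume.real {x ∈ ball x₀ r | (-u) x ≤ -m} := by
    refine le_trans (measureReal_mono ?_ (measure_union_lt_top (hfin _).lt_top
      (hfin _).lt_top).ne) (measureReal_union_le _ _)
    intro x hx
    rcases le_total (u x) m with h1 | h1
    · exact Or.inl ⟨hx, h1⟩
    · exact Or.inr ⟨hx, neg_le_neg h1⟩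
  rcases le_total (volume.real {x ∈ ball x₀ r | (-u) x ≤ -m})
    (volume.real {x ∈ ball x₀ r | u x ≤ m}) with h1 | h1
  · exact upper ρ r A m h u x₀ hρ hr hρr hh hu hcont hsub hA hosc (by linarith)
  · obtain ⟨m', hm'⟩ := upper ρ r A (-m) h (-u) x₀ hρ hr hρr hh hu.neg hcont.neg hsub' hA
      hosc.neg (by linarith)
    refine ⟨-m', ?_⟩
    simpa using hm'.neg

theorem IsSymSub.mono {A : ℝ} {U V : Set (EuclideanSpace ℝ (Fin d))}
    (hu : IsSymSub s lam Lam ρ A u U) (hVU : V ⊆ U) : IsSymSub s lam Lam ρ A u V :=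
  fun x hx => hu x (hVU hx)

/-- Essential bounds hold pointwise on open sets of continuity. -/
theorem abs_le_of_ae_abs_le {U : Set (EuclideanSpace ℝ (Fin d))} {M : ℝ} (hU : IsOpen U)
    (hu : ContinuousOn u U) (hM : ∀ᵐ x, |u x| ≤ M) : ∀ x ∈ U, |u x| ≤ M := by
  intro x hx
  by_contra! hlt
  have hopen : IsOpen (U ∩ (fun x => |u x|) ⁻¹' Set.Ioi M) :=
    hu.abs.isOpen_inter_preimage hU isOpen_Ioi
  have hnull : volume (U ∩ (fun x => |u x|) ⁻¹' Set.Ioi M) = 0 := by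
    refine measure_mono_null (fun y hy => ?_) (ae_iff.1 hM)
    exact not_le.2 hy.2
  exact Set.eq_empty_iff_forall_notMem.1 ((hopen.measure_eq_zero_iff volume).1 hnull) x ⟨hx, hlt⟩

theorem ae_abs_le_eLpNorm_top (hu : MemLp u ∞ volume) :
    ∀ᵐ x, |u x| ≤ (eLpNorm u ∞ volume).toReal := by
  rw [eLpNorm_exponent_top]
  filter_upwards [ae_le_eLpNormEssSup (f := u) (μ := volume)] with x hx
  have htop : eLpNormEssSup u volume ≠ ∞ := by
    simpa [eLpNorm_exponent_top] using hu.eLpNorm_ne_top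
  rw [← Real.norm_eq_abs, ← toReal_enorm]
  exact ENNReal.toReal_mono htop hx

end IntegroDiff

/-! ### Iteration and the Hölder estimate. -/

theorem mainTheorem8 (d : ℕ) (hd : 1 ≤ d) (s lam Lam : ℝ) (hs0 : 0 < s) (hs1 : s < 1)
    (hlam : 0 < lam) (hLam : 0 < Lam) :
    ∃ α C : ℝ, 0 < α ∧ α < 2 * s ∧ 0 < C ∧
      ∀ (A ρ R : ℝ) (u : EuclideanSpace ℝ (Fin d) → ℝ),
        0 ≤ A → 0 < ρ → 2 * ρ < R →
        ContinuousOn u (Metric.ball 0 R) →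
        MeasureTheory.MemLp u ⊤ MeasureTheory.volume →
        (∀ x ∈ Metric.ball (0 : EuclideanSpace ℝ (Fin d)) R,
          ((-A : ℝ) : EReal) ≤ IntegroDiff.symSup s lam Lam ρ u x) →
        (∀ x ∈ Metric.ball (0 : EuclideanSpace ℝ (Fin d)) R,
          IntegroDiff.symInf s lam Lam ρ u x ≤ ((A : ℝ) : EReal)) →
        ∀ x ∈ Metric.ball (0 : EuclideanSpace ℝ (Fin d)) (R / 4),
          ∀ y ∈ Metric.ball (0 : EuclideanSpace ℝ (Fin d)) (R / 4), ρ ≤ ‖x - y‖ →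
            |u x - u y| / ‖x - y‖ ^ α ≤
              C / R ^ α *
                ((MeasureTheory.eLpNorm u ⊤ MeasureTheory.volume).toReal + R ^ (2 * s) * A) := by
  obtain ⟨α, η, hα0, hαs, hη, H⟩ := IntegroDiff.exists_osc_decay d hs0 hs1 hlam hLam
  refine ⟨α, 2 * 4 ^ α * (1 + 1 / η), hα0, hαs, by positivity, ?_⟩
  intro A ρ R u hA hρ hρR hcont hu hsup hinf x hx y hy hxy
  have hR : 0 < R := by linarith
  have hsub := IntegroDiff.isSymSub_of_le_symSup hsup
  have hsub' := IntegroDiff.isSymSub_neg_of_symInf_le hinf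
  set N : ℝ := (MeasureTheory.eLpNorm u ⊤ MeasureTheory.volume).toReal with hN
  have hN0 : 0 ≤ N := ENNReal.toReal_nonneg
  have hae : ∀ᵐ z, |u z| ≤ N := IntegroDiff.ae_abs_le_eLpNorm_top hu
  have hpt := IntegroDiff.abs_le_of_ae_abs_le Metric.isOpen_ball hcont hae
  have hxy0 : 0 < ‖x - y‖ := hρ.trans_le hxy
  rw [mem_ball_zero_iff] at hx hy
  have hxyR : ‖x - y‖ < R / 2 := (norm_sub_le x y).trans_lt (by linarith)
  have hball : Metric.ball x (3 * R / 4) ⊆ Metric.ball 0 R := by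
    refine Metric.ball_subset_ball' ?_
    rw [dist_zero_right]
    linarith
  have hq0 : 0 < (2 : ℝ) ^ (-α) := by positivity
  -- The decay step needs a positive height and a strict bound on `A`, hence a strict lower bound on
  -- `L`; `hfin` removes it by letting `L` decrease to the limit.
  have iter : ∀ L : ℝ, N + A * R ^ (2 * s) / η < L → ∀ k : ℕ,
      ρ ≤ (1 / 2) ^ k * (3 * R / 4) → ∃ m, IntegroDiff.OscBound α u x
        ((1 / 2) ^ k * (3 * R / 4)) m (((2 : ℝ) ^ (-α)) ^ k * L) := by
    intro L hL
    have hAR : 0 ≤ A * R ^ (2 * s) / η := by positivity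
    have hL0 : 0 < L := by linarith
    intro k
    induction k with
    | zero =>
      intro _
      refine ⟨0, fun z hz => ?_, ?_⟩
      · have := hpt z (hball (by simpa using hz))
        simp only [sub_zero, pow_zero, one_mul]
        linarith
      · filter_upwards [hae] with z hz hzn
        simp only [pow_zero, one_mul, Metric.mem_ball, not_lt, dist_eq_norm] at hzn ⊢
        have h1 : 1 ≤ (2 * ‖z - x‖ / (3 * R / 4)) ^ α := by
          refine Real.one_le_rpow ?_ hα0.le
          rw [one_le_div (by positivity)]
          linarith
        have h2 : L * 1 ≤ L * (2 * (2 * ‖z - x‖ / (3 * R / 4)) ^ α - 1) :=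
          mul_le_mul_of_nonneg_left (by linarith) hL0.le
        rw [sub_zero]
        linarith
    | succ k ih =>
      intro hk
      have hhalf : (1 / 2 : ℝ) ^ (k + 1) * (3 * R / 4) = (1 / 2) ^ k * (3 * R / 4) / 2 := by
        rw [pow_succ]
        ring
      have hpow : ((2 : ℝ) ^ (-α)) ^ (k + 1) * L = 2 ^ (-α) * (((2 : ℝ) ^ (-α)) ^ k * L) := by
        rw [pow_succ]
        ring
      rw [hhalf] at hk ⊢
      rw [hpow]
      have hr : 0 < (1 / 2 : ℝ) ^ k * (3 * R / 4) := by positivity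
      obtain ⟨m, hm⟩ := ih (by linarith)
      have hrR : (1 / 2 : ℝ) ^ k * (3 * R / 4) ≤ (1 / 2 : ℝ) ^ k * R := by
        gcongr
        linarith
      have hk1 : (1 / 2 : ℝ) ^ k ≤ 1 := pow_le_one₀ (by norm_num) (by norm_num)
      have hsubs : Metric.ball x ((1 / 2 : ℝ) ^ k * (3 * R / 4)) ⊆ Metric.ball 0 R := by
        refine (Metric.ball_subset_ball ?_).trans hball
        exact mul_le_of_le_one_left (by positivity) hk1
      refine H ρ _ A m _ u x hρ hr (by linarith) (by positivity) hu (hcont.mono hsubs)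
        (hsub.mono hsubs) (hsub'.mono hsubs) ?_ hm
      have h1 : A < L * (η * R ^ (-(2 * s))) := by
        have h2 : A * R ^ (2 * s) / η < L := by linarith
        rw [div_lt_iff₀ hη] at h2
        rw [Real.rpow_neg hR.le, ← mul_assoc, ← div_eq_mul_inv, lt_div_iff₀ (by positivity)]
        exact h2
      refine h1.trans_le ?_
      have h3 : ((1 / 2 : ℝ) ^ k * R) ^ (-(2 * s)) ≤
          ((1 / 2 : ℝ) ^ k * (3 * R / 4)) ^ (-(2 * s)) :=
        Real.rpow_le_rpow_of_nonpos hr hrR (by linarith)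
      -- Each halving costs `2 ^ (-α)` in height but gains `2 ^ (2s)` in `r ^ (-2s)`, so the
      -- smallness of `A` persists because `α < 2s`.
      have h4 : 1 ≤ ((2 : ℝ) ^ (-α)) ^ k * ((1 / 2 : ℝ) ^ k) ^ (-(2 * s)) := by
        have h5 : ((1 / 2 : ℝ) ^ k) ^ (-(2 * s)) = (2 ^ (2 * s)) ^ k := by
          rw [one_div, inv_pow, Real.rpow_neg (by positivity), Real.inv_rpow (by positivity),
            inv_inv, ← Real.rpow_natCast, ← Real.rpow_natCast, ← Real.rpow_mul two_pos.le,
            ← Real.rpow_mul two_pos.le, mul_comm]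
        rw [h5, ← mul_pow, ← Real.rpow_add two_pos]
        exact one_le_pow₀ (Real.one_le_rpow (by norm_num) (by linarith))
      calc L * (η * R ^ (-(2 * s))) = 1 * (L * (η * R ^ (-(2 * s)))) := (one_mul _).symm
        _ ≤ (((2 : ℝ) ^ (-α)) ^ k * ((1 / 2 : ℝ) ^ k) ^ (-(2 * s))) *
            (L * (η * R ^ (-(2 * s)))) := by gcongr
        _ = ((2 : ℝ) ^ (-α)) ^ k * L * (η * ((1 / 2 : ℝ) ^ k * R) ^ (-(2 * s))) := by
            rw [Real.mul_rpow (by positivity) hR.le]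
            ring
        _ ≤ _ := by gcongr
  have main : ∀ L : ℝ, N + A * R ^ (2 * s) / η < L →
      |u x - u y| ≤ 2 * (4 * ‖x - y‖ / R) ^ α * L := by
    intro L hL
    have hL0 : 0 ≤ L := by
      have hAR : 0 ≤ A * R ^ (2 * s) / η := by positivity
      linarith
    -- Here `(1/2) ^ (n+1) < 2‖x - y‖/R ≤ (1/2) ^ n`. The upper bound puts `y` in the ball of radius
    -- `(1/2) ^ n · 3R/4` around `x` and, with `ρ ≤ ‖x - y‖`, makes this scale reachable; the lower
    -- bound gives the factor `4`.
    obtain ⟨n, hn1, hn2⟩ := exists_nat_pow_near_of_lt_one (x := 2 * ‖x - y‖ / R)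
      (y := (1 / 2 : ℝ)) (by positivity) (by rw [div_le_one hR]; linarith) (by norm_num)
      (by norm_num)
    have hn3 : 2 * ‖x - y‖ ≤ (1 / 2) ^ n * R := (div_le_iff₀ hR).1 hn2
    have hn0 : 0 < (1 / 2 : ℝ) ^ n * R := by positivity
    obtain ⟨m, hm, -⟩ := iter L hL n (by linarith)
    have hux := hm x (Metric.mem_ball_self (by positivity))
    have huy := hm y (by
      rw [Metric.mem_ball, dist_comm, dist_eq_norm]
      linarith)
    have hpow : ((2 : ℝ) ^ (-α)) ^ n ≤ (4 * ‖x - y‖ / R) ^ α := by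
      have h1 : ((2 : ℝ) ^ (-α)) ^ n = ((1 / 2 : ℝ) ^ n) ^ α := by
        rw [Real.rpow_neg two_pos.le, ← Real.inv_rpow two_pos.le, one_div, ← Real.rpow_natCast,
          ← Real.rpow_natCast, ← Real.rpow_mul (by norm_num), ← Real.rpow_mul (by norm_num),
          mul_comm]
      rw [h1]
      refine Real.rpow_le_rpow (by positivity) ?_ hα0.le
      rw [pow_succ] at hn1
      have h2 : 4 * ‖x - y‖ / R = 2 * (2 * ‖x - y‖ / R) := by ring
      linarith
    have h3 := mul_le_mul_of_nonneg_right hpow hL0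
    rw [abs_le] at hux huy ⊢
    constructor <;> linarith [hux.1, hux.2, huy.1, huy.2]
  have hfin : |u x - u y| ≤ 2 * (4 * ‖x - y‖ / R) ^ α * (N + A * R ^ (2 * s) / η) := by
    have hc : 0 < 2 * (4 * ‖x - y‖ / R) ^ α := by positivity
    rw [← div_le_iff₀' hc]
    refine le_of_forall_gt_imp_ge_of_dense fun L hL => ?_
    rw [div_le_iff₀' hc]
    exact main L hL
  rw [div_le_iff₀ (by positivity)]
  refine hfin.trans ?_
  have e : (4 * ‖x - y‖ / R) ^ α = 4 ^ α * ‖x - y‖ ^ α / R ^ α := by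
    rw [Real.div_rpow (by positivity) hR.le, Real.mul_rpow (by norm_num) hxy0.le]
  have hle : N + A * R ^ (2 * s) / η ≤ (1 + 1 / η) * (N + R ^ (2 * s) * A) := by
    have h1 : 0 ≤ 1 / η * N := by positivity
    have h2 : 0 ≤ R ^ (2 * s) * A := by positivity
    have h3 : (1 + 1 / η) * (N + R ^ (2 * s) * A) =
      N + A * R ^ (2 * s) / η + (1 / η * N + R ^ (2 * s) * A) := by ring
    linarith
  calc 2 * (4 * ‖x - y‖ / R) ^ α * (N + A * R ^ (2 * s) / η)
      ≤ 2 * (4 * ‖x - y‖ / R) ^ α * ((1 + 1 / η) * (N + R ^ (2 * s) * A)) := by gcongr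
    _ = _ := by
      rw [e]
      ring
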